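/- For a Lie group $G$ acting smoothly on a smooth manifold $M$, let $\mathcal C^\infty(M,\mathbb R)$ carry the $\mathcal C^\infty$-topology (uniform convergence on compact subsets of charts of all derivatives) and the $G$-action $(\alpha\cdot f)(x)=f(\alpha^{-1}x)$. For a topological vector space $V$ with linear $G$-action, the first differentiable cohomology is $H^1_d(G,V)=Z^1_d/B^1_d$, where $Z^1_d$ is the space of smooth maps $\lambda:G\to V$ with $\alpha\cdot\lambda(\beta)-\lambda(\alpha\beta)+\lambda(\alpha)=0$ for all $\alpha,\beta\in G$, and $B^1_d$ is the space of the maps $\alpha\mapsto \alpha\cdot v-v$ with $v\in V$. Let $n\ge 0$ be an integer. Let $\mathrm{SU}(n+1,1)$ (respectively $\mathrm{SO}(n+1,1)$) be the group of complex (respectively real) matrices of determinant one that preserve the form $\sum_{i=1}^{n+1}|z_i|^2-|w|^2$ on $\mathbb C^{n+1}\times\mathbb C$ (respectively on $\mathbb R^{n+1}\times\mathbb R$). It acts on the unit sphere $S^{2n+1}\subset\mathbb C^{n+1}$ (respectively $S^n\subset\mathbb R^{n+1}$) through the identification of $x$ with the isotropic line spanned by $(x,1)$; that is, $A\cdot x=t^{-1}y$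 if $A(x,1)=(y,t)$. Then $$H^1_d\bigl(\mathrm{SU}(n+1,1),\,\mathcal C^\infty(S^{2n+1},\mathbb R)\bigr)\neq\{0\}\quad\text{and}\quad H^1_d\bigl(\mathrm{SO}(n+1,1),\,\mathcal C^\infty(S^{n},\mathbb R)\bigr)\neq\{0\}.$$ -/

import Mathlib

open scoped Manifold ContDiff Topology Matrix

noncomputable section

namespace DiffCohomology

/-! ## Smooth maps from finite-dimensional spaces into topological vector spaces -/

section Calculus

variable {E V : Type*} [AddCommGroup E] [Module ℝ E]
  [AddCommGroup V] [Module ℝ V] [TopologicalSpace V]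

/-- `w` is the derivative of `f` at `x` in the direction `v`: the difference quotients
`(f (x + t v) - f x) / t` converge to `w` in the topological vector space `V` as `t → 0`. -/
def HasDirDerivAt (f : E → V) (w : V) (x v : E) : Prop :=
  Filter.Tendsto (fun t : ℝ => t⁻¹ • (f (x + t • v) - f x)) (𝓝[≠] 0) (𝓝 w)

theorem HasDirDerivAt.add [IsTopologicalAddGroup V] {f g : E → V} {a b : V} {x v : E}
    (hf : HasDirDerivAt f a x v) (hg : HasDirDerivAt g b x v) :
    HasDirDerivAt (f + g) (a + b) x v := by
  refine (Filter.Tendsto.add hf hg).congr fun t => ?_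
  simp only [Pi.add_apply, ← smul_add]
  congr 1
  abel

theorem HasDirDerivAt.const_smul [ContinuousSMul ℝ V] {f : E → V} {a : V} {x v : E}
    (c : ℝ) (hf : HasDirDerivAt f a x v) : HasDirDerivAt (c • f) (c • a) x v := by
  refine (Filter.Tendsto.const_smul hf c).congr fun t => ?_
  simp only [Pi.smul_apply, ← smul_sub, smul_comm c]

variable [TopologicalSpace E]

/-- `f` is of class `C^k` on the (open) set `U` of a finite-dimensional space: all iterated
directional derivatives of order at most `k` exist on `U` and are continuous there. -/
def IsCkOn (U : Set E) : ℕ → (E → V) → Prop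
  | 0, f => ContinuousOn f U
  | k + 1, f => ContinuousOn f U ∧
      ∀ v : E, ∃ f' : E → V, (∀ x ∈ U, HasDirDerivAt f (f' x) x v) ∧ IsCkOn U k f'

/-- `f` is smooth on the (open) set `U` of a finite-dimensional space. -/
def IsSmoothOn (U : Set E) (f : E → V) : Prop := ∀ k : ℕ, IsCkOn U k f

theorem IsCkOn.add [IsTopologicalAddGroup V] {U : Set E} {k : ℕ} {f g : E → V}
    (hf : IsCkOn U k f) (hg : IsCkOn U k g) : IsCkOn U k (f + g) := by
  induction k generalizing f g with
  | zero => exact ContinuousOn.add hf hg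
  | succ k ih =>
    refine ⟨ContinuousOn.add hf.1 hg.1, fun v => ?_⟩
    obtain ⟨f', hf', hf''⟩ := hf.2 v
    obtain ⟨g', hg', hg''⟩ := hg.2 v
    exact ⟨f' + g', fun x hx => (hf' x hx).add (hg' x hx), ih hf'' hg''⟩

theorem IsCkOn.const_smul [ContinuousSMul ℝ V] {U : Set E} {k : ℕ} {f : E → V}
    (c : ℝ) (hf : IsCkOn U k f) : IsCkOn U k (c • f) := by
  induction k generalizing f with
  | zero => exact ContinuousOn.const_smul hf c
  | succ k ih =>
    refine ⟨ContinuousOn.const_smul hf.1 c, fun v => ?_⟩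
    obtain ⟨f', hf', hf''⟩ := hf.2 v
    exact ⟨c • f', fun x hx => (hf' x hx).const_smul c, ih hf''⟩

theorem isCkOn_zero [IsTopologicalAddGroup V] (U : Set E) (k : ℕ) :
    IsCkOn U k (0 : E → V) := by
  induction k with
  | zero => exact continuousOn_const
  | succ k ih =>
    refine ⟨continuousOn_const, fun v => ⟨0, fun x _ => ?_, ih⟩⟩
    simpa [HasDirDerivAt] using tendsto_const_nhds

theorem IsCkOn.mono {U U' : Set E} (h : U' ⊆ U) {k : ℕ} {f : E → V}
    (hf : IsCkOn U k f) : IsCkOn U' k f := by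
  induction k generalizing f with
  | zero => exact ContinuousOn.mono hf h
  | succ k ih =>
    refine ⟨ContinuousOn.mono hf.1 h, fun v => ?_⟩
    obtain ⟨f', hf', hf''⟩ := hf.2 v
    exact ⟨f', fun x hx => hf' x (h hx), ih hf''⟩

end Calculus

/-! ## The `C^∞`-topology on the space of smooth functions on a manifold -/

section SmoothFunctions

variable {E : Type*} [NormedAddCommGroup E] [NormedSpace ℝ E]
  {M : Type*} [TopologicalSpace M] [ChartedSpace E M] [IsManifold 𝓘(ℝ, E) ∞ M]

theorem contDiffOn_chart (f : C^∞⟮𝓘(ℝ, E), M; ℝ⟯) (x : M) :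
    ContDiffOn ℝ ∞ (f ∘ (chartAt E x).symm) (chartAt E x).target := by
  rw [← contMDiffOn_iff_contDiffOn]
  exact f.contMDiff.comp_contMDiffOn (contMDiffOn_chart_symm (I := 𝓘(ℝ, E)) (n := ∞))

theorem contDiffAt_chart (f : C^∞⟮𝓘(ℝ, E), M; ℝ⟯) (x : M) {y : E}
    (hy : y ∈ (chartAt E x).target) :
    ContDiffAt ℝ ∞ (f ∘ (chartAt E x).symm) y :=
  (contDiffOn_chart f x).contDiffAt ((chartAt E x).open_target.mem_nhds hy)

/-- The `k`-th derivative of the local expression of a smooth function in the chart at `x`, as a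
continuous function on the domain `(chartAt E x).target` of the coordinates. -/
def jet (x : M) (k : ℕ) : C^∞⟮𝓘(ℝ, E), M; ℝ⟯ →ₗ[ℝ] C((chartAt E x).target, E [×k]→L[ℝ] ℝ) where
  toFun f := ⟨fun y => iteratedFDeriv ℝ k (f ∘ (chartAt E x).symm) y, by
    have h : ContinuousOn (iteratedFDeriv ℝ k (f ∘ (chartAt E x).symm)) (chartAt E x).target :=
      ((contDiffOn_chart f x).continuousOn_iteratedFDerivWithin (m := k)
        (by exact_mod_cast le_top) (chartAt E x).open_target.uniqueDiffOn).congr fun y hy =>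
          (iteratedFDerivWithin_of_isOpen k (chartAt E x).open_target hy).symm
    exact continuousOn_iff_continuous_domRestrict.1 h⟩
  map_add' f g := by
    ext1 y
    exact iteratedFDeriv_add_apply ((contDiffAt_chart f x y.2).of_le (by exact_mod_cast le_top))
      ((contDiffAt_chart g x y.2).of_le (by exact_mod_cast le_top))
  map_smul' c f := by
    ext1 y
    exact iteratedFDeriv_const_smul_apply
      ((contDiffAt_chart f x y.2).of_le (by exact_mod_cast le_top))

/-- The `C^∞`-topology on `C^∞(M, ℝ)`: uniform convergence on compact subsets of the coordinate
domains of the local expressions together with all their derivatives. -/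
instance smoothTopology : TopologicalSpace C^∞⟮𝓘(ℝ, E), M; ℝ⟯ :=
  ⨅ (x : M) (k : ℕ), TopologicalSpace.induced (jet (E := E) x k) inferInstance

instance : IsTopologicalAddGroup C^∞⟮𝓘(ℝ, E), M; ℝ⟯ :=
  topologicalAddGroup_iInf fun x => topologicalAddGroup_iInf fun k =>
    topologicalAddGroup_induced (jet (E := E) x k)

instance : ContinuousSMul ℝ C^∞⟮𝓘(ℝ, E), M; ℝ⟯ :=
  continuousSMul_iInf fun x => continuousSMul_iInf fun k =>
    continuousSMul_induced (jet (E := E) x k)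

/-- If a group `G` acts on `M` by smooth maps, then `C^∞(M, ℝ)` is a `G`-module through
`(g • f) x = f (g⁻¹ • x)`. -/
def functionModule (G : Type*) [Group G] [MulAction G M]
    (hG : ∀ g : G, ContMDiff 𝓘(ℝ, E) 𝓘(ℝ, E) ∞ (fun x : M => g • x)) :
    Representation ℝ G C^∞⟮𝓘(ℝ, E), M; ℝ⟯ where
  toFun g :=
    { toFun := fun f => ⟨fun x => f (g⁻¹ • x), f.contMDiff.comp (hG g⁻¹)⟩
      map_add' := fun _ _ => rfl
      map_smul' := fun _ _ => rfl }
  map_one' := by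
    ext f x
    change f ((1 : G)⁻¹ • x) = f x
    simp
  map_mul' g h := by
    ext f x
    change f ((g * h)⁻¹ • x) = f (h⁻¹ • g⁻¹ • x)
    rw [mul_inv_rev, mul_smul]

end SmoothFunctions

/-! ## Differentiable cohomology of linear Lie groups -/

section Cohomology

variable {𝕜 : Type} [RCLike 𝕜] {m : Type} [Fintype m] [DecidableEq m]
  {V : Type} [AddCommGroup V] [Module ℝ V] [TopologicalSpace V]

/-- Let `G` be a closed subgroup of `SL(m, 𝕜)`, hence an embedded submanifold of the real vector
space of matrices. A map from `G` to a topological vector space is smooth if near every point of `G`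
it is the restriction of a smooth map that is defined on an open set of matrices. -/
def IsSmooth (G : Subgroup (Matrix.SpecialLinearGroup m 𝕜)) (f : G → V) : Prop :=
  ∀ g : G, ∃ U : Set (Matrix m m 𝕜), IsOpen U ∧ (g : Matrix.SpecialLinearGroup m 𝕜).1 ∈ U ∧
    ∃ F : Matrix m m 𝕜 → V, IsSmoothOn U F ∧
      ∀ h : G, (h : Matrix.SpecialLinearGroup m 𝕜).1 ∈ U →
        f h = F (h : Matrix.SpecialLinearGroup m 𝕜).1

/-- The space `C^1_d(G; V) = C^∞(G, V)` of smooth one-cochains. -/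
def smoothCochains (G : Subgroup (Matrix.SpecialLinearGroup m 𝕜)) (V : Type) [AddCommGroup V]
    [Module ℝ V] [TopologicalSpace V] [IsTopologicalAddGroup V] [ContinuousSMul ℝ V] :
    Submodule ℝ (G → V) where
  carrier := {f | IsSmooth G f}
  add_mem' := by
    intro f₁ f₂ h₁ h₂ g
    obtain ⟨U₁, hU₁, hg₁, F₁, hF₁, hf₁⟩ := h₁ g
    obtain ⟨U₂, hU₂, hg₂, F₂, hF₂, hf₂⟩ := h₂ g
    refine ⟨U₁ ∩ U₂, hU₁.inter hU₂, ⟨hg₁, hg₂⟩, F₁ + F₂, fun k => ?_, fun h hh => ?_⟩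
    · exact ((hF₁ k).mono Set.inter_subset_left).add ((hF₂ k).mono Set.inter_subset_right)
    · simp [hf₁ h hh.1, hf₂ h hh.2]
  zero_mem' := fun g => ⟨Set.univ, isOpen_univ, trivial, 0, isCkOn_zero _, fun _ _ => rfl⟩
  smul_mem' := by
    intro c f hf g
    obtain ⟨U, hU, hg, F, hF, hf⟩ := hf g
    exact ⟨U, hU, hg, c • F, fun k => (hF k).const_smul c, fun h hh => by simp [hf h hh]⟩

variable [IsTopologicalAddGroup V] [ContinuousSMul ℝ V]
  {G : Subgroup (Matrix.SpecialLinearGroup m 𝕜)}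

/-- The inhomogeneous coboundary `∂⁰ v (α) = α • v - v`. -/
def d0 (ρ : Representation ℝ G V) : V →ₗ[ℝ] (G → V) where
  toFun v α := ρ α v - v
  map_add' v w := by
    ext α
    simp only [map_add, Pi.add_apply]
    abel
  map_smul' c v := by
    ext α
    simp [smul_sub]

/-- The inhomogeneous coboundary `∂¹ f (α, β) = α • f β - f (α β) + f α`. -/
def d1 (ρ : Representation ℝ G V) : (G → V) →ₗ[ℝ] (G × G → V) where
  toFun f p := ρ p.1 (f p.2) - f (p.1 * p.2) + f p.1
  map_add' f g := by
    ext p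
    simp only [map_add, Pi.add_apply]
    abel
  map_smul' c f := by
    ext p
    simp [smul_sub]

/-- The smooth one-cocycles `Z^1_d(G; V)`. -/
def Z1d (ρ : Representation ℝ G V) : Submodule ℝ (G → V) :=
  LinearMap.ker (d1 ρ) ⊓ smoothCochains G V

/-- The one-coboundaries `B^1_d(G; V) = ∂⁰ V`. -/
def B1d (ρ : Representation ℝ G V) : Submodule ℝ (G → V) := LinearMap.range (d0 ρ)

/-- The first differentiable cohomology `H^1_d(G, V) = Z^1_d(G; V) / B^1_d(G; V)`. -/
abbrev H1d (ρ : Representation ℝ G V) : Type := Z1d ρ ⧸ (B1d ρ).submoduleOf (Z1d ρ)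

end Cohomology

/-! ## The groups `SU(n+1,1)` and `SO(n+1,1)` and their actions on spheres -/

section Groups

variable (𝕜 : Type) [RCLike 𝕜] (n : ℕ)

/-- The diagonal matrix with `n + 1` entries `1` followed by one entry `-1`. -/
abbrev J : Matrix (Fin (n + 1) ⊕ Unit) (Fin (n + 1) ⊕ Unit) 𝕜 :=
  LieAlgebra.Orthogonal.indefiniteDiagonal (Fin (n + 1)) Unit 𝕜

/-- The group of the matrices over `𝕜` of determinant one that preserve the Hermitian form
`∑ i, |z i|² - |w|²` on `𝕜^{n+1} × 𝕜`. -/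
def specialIsometries : Subgroup (Matrix.SpecialLinearGroup (Fin (n + 1) ⊕ Unit) 𝕜) where
  carrier := {A | A.1ᴴ * J 𝕜 n * A.1 = J 𝕜 n}
  mul_mem' {A B} hA hB := by
    simp only [Set.mem_ofPred_eq] at hA hB ⊢
    calc (A * B).1ᴴ * J 𝕜 n * (A * B).1 = B.1ᴴ * (A.1ᴴ * J 𝕜 n * A.1) * B.1 := by
          simp [Matrix.conjTranspose_mul, Matrix.mul_assoc]
      _ = J 𝕜 n := by rw [hA, hB]
  one_mem' := by simp
  inv_mem' {A} hA := by
    simp only [Set.mem_ofPred_eq] at hA ⊢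
    have h : A.1 * (A⁻¹).1 = 1 := congrArg Subtype.val (mul_inv_cancel A)
    calc (A⁻¹).1ᴴ * J 𝕜 n * (A⁻¹).1
        = (A⁻¹).1ᴴ * (A.1ᴴ * J 𝕜 n * A.1) * (A⁻¹).1 := by rw [hA]
      _ = (A.1 * (A⁻¹).1)ᴴ * J 𝕜 n * (A.1 * (A⁻¹).1) := by
          simp only [Matrix.conjTranspose_mul, Matrix.mul_assoc]
      _ = J 𝕜 n := by
          rw [h, Matrix.conjTranspose_one, Matrix.one_mul, Matrix.mul_one]

/-- `SU(n+1,1)`. -/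
abbrev SU : Subgroup (Matrix.SpecialLinearGroup (Fin (n + 1) ⊕ Unit) ℂ) := specialIsometries ℂ n

/-- `SO(n+1,1)`. Over `ℝ` the conjugate transpose is the transpose. -/
abbrev SO : Subgroup (Matrix.SpecialLinearGroup (Fin (n + 1) ⊕ Unit) ℝ) := specialIsometries ℝ n

/-- The unit sphere of `𝕜^{n+1}`: it is `S^n` for `𝕜 = ℝ` and `S^{2n+1}` for `𝕜 = ℂ`. -/
abbrev Sph : Type := Metric.sphere (0 : EuclideanSpace 𝕜 (Fin (n + 1))) 1

variable {𝕜 n}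

/-- The image `A (x, 1)` of the isotropic vector `(x, 1)` that belongs to a point `x`. -/
def lift (A : Matrix (Fin (n + 1) ⊕ Unit) (Fin (n + 1) ⊕ Unit) 𝕜)
    (x : EuclideanSpace 𝕜 (Fin (n + 1))) : Fin (n + 1) ⊕ Unit → 𝕜 :=
  A *ᵥ Sum.elim x.ofLp (fun _ => 1)

/-- The point `y / t` of `𝕜^{n+1}`, where `A (x, 1) = (y, t)`. -/
def frac (A : Matrix (Fin (n + 1) ⊕ Unit) (Fin (n + 1) ⊕ Unit) 𝕜)
    (x : EuclideanSpace 𝕜 (Fin (n + 1))) : EuclideanSpace 𝕜 (Fin (n + 1)) :=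
  WithLp.toLp 2 fun i => (lift A x (Sum.inr ()))⁻¹ * lift A x (Sum.inl i)

theorem form_eq (v : Fin (n + 1) ⊕ Unit → 𝕜) : star v ⬝ᵥ J 𝕜 n *ᵥ v =
    ((∑ i, ‖v (Sum.inl i)‖ ^ 2 - ‖v (Sum.inr ())‖ ^ 2 : ℝ) : 𝕜) := by
  simp [LieAlgebra.Orthogonal.indefiniteDiagonal, Matrix.mulVec_diagonal, dotProduct,
    ← RCLike.conj_mul, sub_eq_add_neg]

theorem form_lift (A : specialIsometries 𝕜 n) (x : Sph 𝕜 n) :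
    ∑ i, ‖lift A.1.1 x.1 (Sum.inl i)‖ ^ 2 = ‖lift A.1.1 x.1 (Sum.inr ())‖ ^ 2 := by
  have h1 := form_eq (lift A.1.1 x.1)
  have h2 := form_eq (Sum.elim x.1.ofLp (fun _ => (1 : 𝕜)))
  have h3 : star (lift A.1.1 x.1) ⬝ᵥ J 𝕜 n *ᵥ (lift A.1.1 x.1) =
      star (Sum.elim x.1.ofLp (fun _ => (1 : 𝕜))) ⬝ᵥ
        J 𝕜 n *ᵥ (Sum.elim x.1.ofLp (fun _ => (1 : 𝕜))) := by
    have hA : A.1.1ᴴ * J 𝕜 n * A.1.1 = J 𝕜 n := A.2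
    conv_rhs => rw [← hA]
    simp only [lift, Matrix.star_mulVec, Matrix.dotProduct_mulVec, Matrix.vecMul_vecMul,
      Matrix.mul_assoc]
  have hx : ∑ i, ‖x.1.ofLp i‖ ^ 2 = 1 := by
    rw [← EuclideanSpace.norm_sq_eq, norm_eq_of_mem_sphere x]; norm_num
  rw [h1, h2] at h3
  have h4 := RCLike.ofReal_injective h3
  simp only [Sum.elim_inl, Sum.elim_inr, hx, norm_one] at h4
  linarith

theorem lift_last_ne_zero (A : specialIsometries 𝕜 n) (x : Sph 𝕜 n) :
    lift A.1.1 x.1 (Sum.inr ()) ≠ 0 := by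
  intro h0
  have h := form_lift A x
  rw [h0] at h
  have hz : lift A.1.1 x.1 = 0 := by
    ext j
    rcases j with i | j
    · have := (Finset.sum_eq_zero_iff_of_nonneg (fun i _ => by positivity)).1
        (h.trans (by simp)) i (Finset.mem_univ i)
      simpa using this
    · exact h0
  have h5 : (A⁻¹).1.1 *ᵥ lift A.1.1 x.1 = Sum.elim x.1.ofLp (fun _ => (1 : 𝕜)) := by
    have h6 : (A⁻¹).1.1 * A.1.1 = 1 := congrArg (fun B => B.1.1) (inv_mul_cancel A)
    rw [lift, Matrix.mulVec_mulVec, h6, Matrix.one_mulVec]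
  rw [hz, Matrix.mulVec_zero] at h5
  simpa using congrFun h5 (Sum.inr ())

theorem frac_mem (A : specialIsometries 𝕜 n) (x : Sph 𝕜 n) :
    frac A.1.1 x.1 ∈ Metric.sphere (0 : EuclideanSpace 𝕜 (Fin (n + 1))) 1 := by
  have h0 : ‖lift A.1.1 x.1 (Sum.inr ())‖ ≠ 0 := norm_ne_zero_iff.2 (lift_last_ne_zero A x)
  rw [mem_sphere_zero_iff_norm, EuclideanSpace.norm_eq]
  simp only [frac, norm_mul, mul_pow, ← Finset.mul_sum, form_lift, norm_inv]
  rw [← mul_pow, inv_mul_cancel₀ h0]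
  simp

theorem lift_eq_smul (A : specialIsometries 𝕜 n) (x : Sph 𝕜 n) :
    lift A.1.1 x.1 = lift A.1.1 x.1 (Sum.inr ()) •
      Sum.elim (frac A.1.1 x.1).ofLp (fun _ => (1 : 𝕜)) := by
  ext j
  rcases j with i | j
  · simp [frac, mul_inv_cancel_left₀ (lift_last_ne_zero A x)]
  · simp

theorem lift_mul (A B : specialIsometries 𝕜 n) (x : Sph 𝕜 n) :
    lift (A * B).1.1 x.1 = lift B.1.1 x.1 (Sum.inr ()) • lift A.1.1 (frac B.1.1 x.1) := by
  have h : (A * B).1.1 = A.1.1 * B.1.1 := rfl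
  rw [h, lift, ← Matrix.mulVec_mulVec]
  change A.1.1 *ᵥ lift B.1.1 x.1 = _
  conv_lhs => rw [lift_eq_smul, Matrix.mulVec_smul]
  rfl

/-- The action on the sphere, which is identified with the set of isotropic lines in `𝕜^{n+1} × 𝕜`
through `x ↦ 𝕜 (x, 1)`: one has `A • x = y / t` if `A (x, 1) = (y, t)`. -/
instance sphereAction : MulAction (specialIsometries 𝕜 n) (Sph 𝕜 n) where
  smul A x := ⟨frac A.1.1 x.1, frac_mem A x⟩
  one_smul x := by
    apply Subtype.ext
    change frac (1 : Matrix (Fin (n + 1) ⊕ Unit) (Fin (n + 1) ⊕ Unit) 𝕜) x.1 = x.1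
    ext i
    simp [frac, lift]
  mul_smul A B x := by
    apply Subtype.ext
    change frac (A * B).1.1 x.1 = frac A.1.1 (frac B.1.1 x.1)
    ext i
    have h := lift_last_ne_zero B x
    simp only [frac, lift_mul, Pi.smul_apply, smul_eq_mul, mul_inv]
    field_simp

theorem contDiffAt_frac (A : specialIsometries 𝕜 n) (x : Sph 𝕜 n) :
    ContDiffAt ℝ ∞ (frac A.1.1) x.1 := by
  have h : ∀ j, ContDiff ℝ ∞ fun y : EuclideanSpace 𝕜 (Fin (n + 1)) => lift A.1.1 y j := by
    intro j
    simp only [lift, Matrix.mulVec, dotProduct, Fintype.sum_sum_type, Sum.elim_inl, Sum.elim_inr]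
    fun_prop
  unfold frac
  refine (PiLp.contDiff_toLp (𝕜 := ℝ)).contDiffAt.comp _ (contDiffAt_pi.2 fun i => ?_)
  exact ((h _).contDiffAt.inv (lift_last_ne_zero A x)).mul (h _).contDiffAt

instance finrank_real : Fact (Module.finrank ℝ (EuclideanSpace ℝ (Fin (n + 1))) = n + 1) :=
  ⟨by simp⟩

instance finrank_complex :
    Fact (Module.finrank ℝ (EuclideanSpace ℂ (Fin (n + 1))) = 2 * n + 1 + 1) :=
  ⟨by
    rw [← Module.finrank_mul_finrank ℝ ℂ, Complex.finrank_real_complex, finrank_euclideanSpace_fin]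
    ring⟩

end Groups

theorem contMDiff_SU (n : ℕ) (A : SU n) :
    ContMDiff (𝓡 (2 * n + 1)) (𝓡 (2 * n + 1)) ∞ (fun x : Sph ℂ n => A • x) := by
  refine ContMDiff.codRestrict_sphere (f := fun x : Sph ℂ n => frac A.1.1 x.1) (fun x => ?_) _
  exact (contDiffAt_frac A x).contMDiffAt.comp x contMDiff_coe_sphere.contMDiffAt

theorem contMDiff_SO (n : ℕ) (A : SO n) :
    ContMDiff (𝓡 n) (𝓡 n) ∞ (fun x : Sph ℝ n => A • x) := by
  refine ContMDiff.codRestrict_sphere (f := fun x : Sph ℝ n => frac A.1.1 x.1) (fun x => ?_) _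
  exact (contDiffAt_frac A x).contMDiffAt.comp x contMDiff_coe_sphere.contMDiffAt

/-- The `SU(n+1,1)`-module `C^∞(S^{2n+1}, ℝ)`. -/
def moduleSU (n : ℕ) : Representation ℝ (SU n) C^∞⟮𝓡 (2 * n + 1), Sph ℂ n; ℝ⟯ :=
  functionModule (SU n) (contMDiff_SU n)

/-- The `SO(n+1,1)`-module `C^∞(S^n, ℝ)`. -/
def moduleSO (n : ℕ) : Representation ℝ (SO n) C^∞⟮𝓡 n, Sph ℝ n; ℝ⟯ :=
  functionModule (SO n) (contMDiff_SO n)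

end DiffCohomology

end

/-! Lifting the action to the isotropic cone gives a multiplicative cocycle: if `t(A, x)` is the
last coordinate of `A (x, 1)`, then `t(A B, x) = t(B, x) t(A, B x)` (`lift_mul`). So `A ↦ log
|t(A⁻¹, x)|²` is an additive 1-cocycle with values in functions on the sphere. It is not a
coboundary: `α • f - f` evaluated at a fixed point of `α` is zero, while `boostSq` fixes the first
basis vector and scales its isotropic lift by 4, so that the cocycle takes the value `log 16` there.
The real and complex cases are treated together over `𝕜`. The analytic work is smoothness of the
cocycle as a map into the function space with its `C^∞`-topology. Writing `A⁻¹ = J Aᴴ J` extends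
`t(A⁻¹, x)` to all matrices as an expression jointly smooth in `(A, x)`. By
`isSmoothOn_of_contDiffAt` a jointly smooth expression defines a smooth map into the function space;
this rests on commuting derivatives (`fderiv_partialJet`) and locally uniform convergence of
difference quotients (`tendsto_slope_prod`). -/

noncomputable section

namespace DiffCohomology

/-! ### Calculus of functions of two variables -/

section PartialDerivatives

variable {E F : Type*} [NormedAddCommGroup E] [NormedSpace ℝ E]
  [NormedAddCommGroup F] [NormedSpace ℝ F]

/-- The `k`-th derivative of a function of two variables in the second variable. -/
def partialJet (Ψ : E × F → ℝ) (k : ℕ) (p : E × F) : F [×k]→L[ℝ] ℝ :=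
  iteratedFDeriv ℝ k (fun y => Ψ (p.1, y)) p.2

/-- The derivative of a function of two variables in the direction `v` of the first variable. -/
def partialFst (Ψ : E × F → ℝ) (v : E) (p : E × F) : ℝ := fderiv ℝ Ψ p (v, 0)

theorem fderiv_partial_snd {G : Type*} [NormedAddCommGroup G] [NormedSpace ℝ G]
    {H : E × F → G} {p : E × F} (h : DifferentiableAt ℝ H p) :
    fderiv ℝ (fun y => H (p.1, y)) p.2 =
      (fderiv ℝ H p).comp (ContinuousLinearMap.inr ℝ E F) := by
  have h1 : HasFDerivAt (fun y : F => (p.1, y)) (ContinuousLinearMap.inr ℝ E F) p.2 :=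
    hasFDerivAt_prodMk_right p.1 p.2
  exact (HasFDerivAt.comp p.2 (f := fun y : F => (p.1, y)) (g := H) h.hasFDerivAt h1).fderiv

/-- Expresses the next jet through the full derivative on `E × F`, so that induction on `k` can keep
track of both variables at once. -/
theorem partialJet_succ_apply {Ψ : E × F → ℝ} {k : ℕ} {p : E × F}
    (h : DifferentiableAt ℝ (partialJet Ψ k) p) :
    partialJet Ψ (k + 1) p = (continuousMultilinearCurryLeftEquiv ℝ (fun _ : Fin (k + 1) => F)
      ℝ).symm ((fderiv ℝ (partialJet Ψ k) p).comp (ContinuousLinearMap.inr ℝ E F)) := by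
  rw [← fderiv_partial_snd h, partialJet, iteratedFDeriv_succ_eq_comp_left]
  rfl

variable {s : Set (E × F)} {Ψ : E × F → ℝ}

theorem contDiffOn_partialFst (hs : IsOpen s) (hΨ : ContDiffOn ℝ ∞ Ψ s) (v : E) :
    ContDiffOn ℝ ∞ (partialFst Ψ v) s :=
  (hΨ.fderiv_of_isOpen hs (m := ∞) (by simp)).clm_apply contDiffOn_const

theorem contDiffOn_partialJet (hs : IsOpen s) (hΨ : ContDiffOn ℝ ∞ Ψ s) (k : ℕ) :
    ContDiffOn ℝ ∞ (partialJet Ψ k) s := by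
  induction k with
  | zero =>
    exact (continuousMultilinearCurryFin0 ℝ F ℝ).symm.contDiff.comp_contDiffOn hΨ
  | succ k ih =>
    have h := (ih.fderiv_of_isOpen hs (m := ∞) (by simp)).clm_comp
      (contDiffOn_const (c := ContinuousLinearMap.inr ℝ E F))
    refine ((continuousMultilinearCurryLeftEquiv ℝ (fun _ : Fin (k + 1) => F)
      ℝ).symm.contDiff.comp_contDiffOn h).congr fun p hp => ?_
    exact partialJet_succ_apply ((ih.contDiffAt (hs.mem_nhds hp)).differentiableAt (by simp))

/-- Derivatives in the first and in the second variable commute. -/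
theorem fderiv_partialJet (hs : IsOpen s) (hΨ : ContDiffOn ℝ ∞ Ψ s) (v : E) (k : ℕ) {p : E × F}
    (hp : p ∈ s) : fderiv ℝ (partialJet Ψ k) p (v, 0) = partialJet (partialFst Ψ v) k p := by
  induction k generalizing p with
  | zero =>
    have h : HasFDerivAt (partialJet Ψ 0)
        (((continuousMultilinearCurryFin0 ℝ F ℝ).symm.toContinuousLinearEquiv :
          ℝ →L[ℝ] _).comp (fderiv ℝ Ψ p)) p :=
      ((continuousMultilinearCurryFin0 ℝ F
        ℝ).symm.toContinuousLinearEquiv.hasFDerivAt).comp p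
        ((hΨ.contDiffAt (hs.mem_nhds hp)).differentiableAt (by simp)).hasFDerivAt
    rw [h.fderiv]
    rfl
  | succ k ih =>
    have hH := contDiffOn_partialJet hs hΨ k
    have hd : ∀ q ∈ s, DifferentiableAt ℝ (partialJet Ψ k) q := fun q hq =>
      (hH.contDiffAt (hs.mem_nhds hq)).differentiableAt (by simp)
    have hd2 : DifferentiableAt ℝ (fderiv ℝ (partialJet Ψ k)) p :=
      ((hH.fderiv_of_isOpen hs (m := ∞) (by simp)).contDiffAt
        (hs.mem_nhds hp)).differentiableAt (by simp)
    -- Symmetry of the second derivative is the only reason the derivatives commute; it is applied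
    -- at the end to the vectors `(v, 0)` and `(0, w)`.
    have hsymm : IsSymmSndFDerivAt ℝ (partialJet Ψ k) p :=
      (hH.contDiffAt (hs.mem_nhds hp)).isSymmSndFDerivAt (by
        simpa using (WithTop.coe_le_coe.2 le_top : ((2 : ℕ∞) : WithTop ℕ∞) ≤ ∞))
    set e := (continuousMultilinearCurryLeftEquiv ℝ (fun _ : Fin (k + 1) => F) ℝ).symm
    have hl : partialJet Ψ (k + 1) =ᶠ[𝓝 p] fun q =>
        e ((fderiv ℝ (partialJet Ψ k) q).comp (ContinuousLinearMap.inr ℝ E F)) := by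
      filter_upwards [hs.mem_nhds hp] with q hq using partialJet_succ_apply (hd q hq)
    have hr : partialJet (partialFst Ψ v) k =ᶠ[𝓝 p] fun q =>
        fderiv ℝ (partialJet Ψ k) q (v, 0) := by
      filter_upwards [hs.mem_nhds hp] with q hq using (ih hq).symm
    have hdv := ((contDiffOn_partialJet hs (contDiffOn_partialFst hs hΨ v) k).contDiffAt
      (hs.mem_nhds hp)).differentiableAt (by simp)
    let c := (ContinuousLinearMap.compL ℝ F (E × F) (F [×k]→L[ℝ] ℝ)).flip
      (ContinuousLinearMap.inr ℝ E F)
    let e' : (F →L[ℝ] F [×k]→L[ℝ] ℝ) →L[ℝ] F [×(k + 1)]→L[ℝ] ℝ :=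
      (e.toContinuousLinearEquiv : _ →L[ℝ] _)
    have hL : HasFDerivAt (fun q =>
        e ((fderiv ℝ (partialJet Ψ k) q).comp (ContinuousLinearMap.inr ℝ E F)))
        ((e'.comp c).comp (fderiv ℝ (fderiv ℝ (partialJet Ψ k)) p)) p :=
      HasFDerivAt.comp p (g := e'.comp c) (f := fderiv ℝ (partialJet Ψ k))
        (e'.comp c).hasFDerivAt hd2.hasFDerivAt
    have hR : HasFDerivAt (fun q => fderiv ℝ (partialJet Ψ k) q (v, 0))
        ((ContinuousLinearMap.apply ℝ _ ((v, 0) : E × F)).comp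
          (fderiv ℝ (fderiv ℝ (partialJet Ψ k)) p)) p :=
      HasFDerivAt.comp p (g := ContinuousLinearMap.apply ℝ (F [×k]→L[ℝ] ℝ) ((v, 0) : E × F))
        (f := fderiv ℝ (partialJet Ψ k)) (ContinuousLinearMap.hasFDerivAt _) hd2.hasFDerivAt
    rw [partialJet_succ_apply hdv, hl.fderiv_eq, hL.fderiv, hr.fderiv_eq, hR.fderiv]
    change e _ = e _
    congr 1
    ext1 w
    exact hsymm.eq (v, 0) (0, w)

/-- The difference quotients in a direction of the first variable of a `C^1` function converge
locally uniformly in the second variable. -/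
theorem tendsto_slope_prod {G : Type*} [NormedAddCommGroup G] [NormedSpace ℝ G]
    {H : E × F → G} {b : E} {y : F} (v : E) (hH : ContDiffAt ℝ ∞ H (b, y)) :
    Filter.Tendsto (fun q : ℝ × F => q.1⁻¹ • (H (b + q.1 • v, q.2) - H (b, q.2)))
      (𝓝[≠] 0 ×ˢ 𝓝 y) (𝓝 (fderiv ℝ H (b, y) (v, 0))) := by
  -- Strict differentiability allows both points `(b + t v, y')` and `(b, y')` to move, which yields
  -- uniformity for `y'` near `y`.
  have h := (hH.hasStrictFDerivAt (by simp)).isLittleO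
  have hle : (𝓝[≠] (0 : ℝ) ×ˢ 𝓝 y) ≤ 𝓝 ((0 : ℝ), y) := by
    rw [nhds_prod_eq]
    exact Filter.prod_mono nhdsWithin_le_nhds le_rfl
  have hm : Filter.Tendsto (fun q : ℝ × F => ((b + q.1 • v, q.2), (b, q.2)))
      (𝓝[≠] 0 ×ˢ 𝓝 y) (𝓝 ((b, y), (b, y))) := by
    have hc : Continuous (fun q : ℝ × F => ((b + q.1 • v, q.2), (b, q.2))) := by fun_prop
    have := (hc.tendsto ((0 : ℝ), y)).mono_left hle
    simpa using this
  have h1 := h.comp_tendsto hm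
  have h2 : (fun q : ℝ × F => H (b + q.1 • v, q.2) - H (b, q.2) -
      q.1 • fderiv ℝ H (b, y) (v, 0)) =o[𝓝[≠] 0 ×ˢ 𝓝 y] (fun q => q.1) := by
    refine (h1.congr_left fun q => ?_).trans_isBigO
      (Asymptotics.IsBigO.of_bound ‖v‖ (Filter.Eventually.of_forall fun q => ?_))
    · have : ((b + q.1 • v, q.2) - (b, q.2) : E × F) = q.1 • (v, 0) := by ext <;> simp
      simp only [Function.comp_apply]
      rw [this, map_smul]
    · simp [Prod.norm_def, norm_smul, mul_comm, mul_nonneg]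
  have h3 := h2.tendsto_inv_smul_nhds_zero
  have h0 : ∀ᶠ q : ℝ × F in 𝓝[≠] 0 ×ˢ 𝓝 y, q.1 ≠ 0 :=
    Filter.tendsto_fst.eventually self_mem_nhdsWithin
  have h4 := h3.add_const (fderiv ℝ H (b, y) (v, 0))
  rw [zero_add] at h4
  refine h4.congr' ?_
  filter_upwards [h0] with q hq
  rw [smul_sub _ _ (q.1 • _), inv_smul_smul₀ hq]
  abel

end PartialDerivatives

/-! ### Smooth families of functions as smooth maps into `C^∞(M, ℝ)` -/

section SmoothFamilies

variable {W E F M : Type*} [NormedAddCommGroup W] [NormedSpace ℝ W]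
  [NormedAddCommGroup E] [NormedSpace ℝ E] [NormedAddCommGroup F] [NormedSpace ℝ F]
  [TopologicalSpace M] [ChartedSpace F M] [IsManifold 𝓘(ℝ, F) ∞ M]
  {j : M → W} {U : Set E} {Φ : E × W → ℝ}

/-- Locally uniform convergence implies convergence in the compact-open topology, and it follows
from joint convergence at each point because the limit is continuous. -/
theorem tendsto_continuousMap_of_forall {ι X Y : Type*} [TopologicalSpace X]
    [PseudoMetricSpace Y] {l : Filter ι} {f : ι → C(X, Y)} {g : C(X, Y)}
    (h : ∀ x, Filter.Tendsto (fun q : ι × X => f q.1 q.2) (l ×ˢ 𝓝 x) (𝓝 (g x))) :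
    Filter.Tendsto f l (𝓝 g) := by
  refine ContinuousMap.tendsto_of_tendstoLocallyUniformly
    (tendstoLocallyUniformly_iff_forall_tendsto.2 fun x => ?_)
  refine Filter.Tendsto.mono_right ?_ (nhds_le_uniformity (g x))
  rw [nhds_prod_eq]
  exact ((g.continuous.tendsto x).comp Filter.tendsto_snd).prodMk (h x)

theorem tendsto_smoothFunctions_iff {ι : Type*} {l : Filter ι} {f : ι → C^∞⟮𝓘(ℝ, F), M; ℝ⟯}
    {g : C^∞⟮𝓘(ℝ, F), M; ℝ⟯} : Filter.Tendsto f l (𝓝 g) ↔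
      ∀ (x : M) (k : ℕ), Filter.Tendsto (fun i => jet (E := F) x k (f i)) l
        (𝓝 (jet (E := F) x k g)) := by
  simp only [nhds_iInf, nhds_induced, Filter.tendsto_iInf,
    Filter.tendsto_comap_iff, Function.comp_def]

/-- A function on `E × W` in the coordinates of a chart of `M`, where `j : M → W`. -/
def localExpr (j : M → W) (Φ : E × W → ℝ) (x : M) (p : E × F) : ℝ :=
  Φ (p.1, j ((chartAt F x).symm p.2))

theorem contDiffOn_comp_chart_symm (hj : ContMDiff 𝓘(ℝ, F) 𝓘(ℝ, W) ∞ j) (x : M) :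
    ContDiffOn ℝ ∞ (j ∘ (chartAt F x).symm) (chartAt F x).target := by
  rw [← contMDiffOn_iff_contDiffOn]
  exact hj.comp_contMDiffOn (contMDiffOn_chart_symm (I := 𝓘(ℝ, F)) (n := ∞))

theorem contDiffOn_localExpr (hj : ContMDiff 𝓘(ℝ, F) 𝓘(ℝ, W) ∞ j)
    (hΦ : ∀ b ∈ U, ∀ z : M, ContDiffAt ℝ ∞ Φ (b, j z)) (x : M) :
    ContDiffOn ℝ ∞ (localExpr (F := F) j Φ x) (U ×ˢ (chartAt F x).target) := by
  have h := contDiffOn_comp_chart_symm hj x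
  rintro ⟨b, y⟩ ⟨hb, hy⟩
  refine ContDiffAt.contDiffWithinAt ?_
  refine ContDiffAt.comp (b, y) (g := Φ)
    (f := fun p : E × F => (p.1, j ((chartAt F x).symm p.2))) (hΦ b hb _) ?_
  exact contDiffAt_fst.prodMk
    ((h.contDiffAt ((chartAt F x).open_target.mem_nhds hy)).comp (b, y) contDiffAt_snd)

omit [NormedAddCommGroup W] [NormedSpace ℝ W] [NormedAddCommGroup E] [NormedSpace ℝ E] in
theorem jet_eq_partialJet {f : E → C^∞⟮𝓘(ℝ, F), M; ℝ⟯} {b : E}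
    (hf : ∀ z, f b z = Φ (b, j z)) (x : M) (k : ℕ) (y : (chartAt F x).target) :
    jet (E := F) x k (f b) y = partialJet (localExpr (F := F) j Φ x) k (b, (y : F)) := by
  change iteratedFDeriv ℝ k (f b ∘ (chartAt F x).symm) y = _
  have : (f b ∘ (chartAt F x).symm) = fun y : F => localExpr j Φ x (b, y) := by
    ext y
    exact hf _
  rw [this, partialJet]

/-- The chart affects only the second variable, so differentiating in the parameter gives a local
expression of the same kind. This is what makes the smoothness argument iterable. -/
theorem partialFst_localExpr (hj : ContMDiff 𝓘(ℝ, F) 𝓘(ℝ, W) ∞ j) {b : E}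
    (hΦ : ∀ z : M, ContDiffAt ℝ ∞ Φ (b, j z)) (x : M) (v : E) {y : F}
    (hy : y ∈ (chartAt F x).target) :
    partialFst (localExpr (F := F) j Φ x) v (b, y) =
      localExpr j (fun p => fderiv ℝ Φ p (v, 0)) x (b, y) := by
  have h : DifferentiableAt ℝ (j ∘ (chartAt F x).symm) y :=
    ((contDiffOn_comp_chart_symm hj x).contDiffAt
      ((chartAt F x).open_target.mem_nhds hy)).differentiableAt (by simp)
  have h1 : HasFDerivAt (fun p : E × F => (p.1, j ((chartAt F x).symm p.2)))
      ((ContinuousLinearMap.fst ℝ E F).prod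
        ((fderiv ℝ (j ∘ (chartAt F x).symm) y).comp (ContinuousLinearMap.snd ℝ E F))) (b, y) :=
    hasFDerivAt_fst.prodMk (HasFDerivAt.comp (b, y) (g := j ∘ (chartAt F x).symm)
      (f := Prod.snd) h.hasFDerivAt hasFDerivAt_snd)
  have h2 : HasFDerivAt (localExpr (F := F) j Φ x) _ (b, y) :=
    HasFDerivAt.comp (b, y) (g := Φ)
      ((hΦ ((chartAt F x).symm y)).differentiableAt (by simp)).hasFDerivAt h1
  rw [partialFst, h2.fderiv]
  simp [localExpr]

omit [IsManifold 𝓘(ℝ, F) ∞ M] in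
theorem contMDiff_slice (hj : ContMDiff 𝓘(ℝ, F) 𝓘(ℝ, W) ∞ j) {b : E}
    (hΦ : ∀ z : M, ContDiffAt ℝ ∞ Φ (b, j z)) :
    ContMDiff 𝓘(ℝ, F) 𝓘(ℝ, ℝ) ∞ (fun z => Φ (b, j z)) := fun z =>
  ContMDiffAt.comp z (g := fun w => Φ (b, w)) (I' := 𝓘(ℝ, W))
    (((hΦ z).comp (j z) (contDiffAt_const.prodMk contDiffAt_id)).contMDiffAt) hj.contMDiffAt

/-- The function `z ↦ Φ (b, j z)` as an element of the space of smooth functions. -/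
def slice (hj : ContMDiff 𝓘(ℝ, F) 𝓘(ℝ, W) ∞ j) (b : E)
    (hΦ : ∀ z : M, ContDiffAt ℝ ∞ Φ (b, j z)) : C^∞⟮𝓘(ℝ, F), M; ℝ⟯ :=
  ⟨_, contMDiff_slice hj hΦ⟩

open Classical in
/-- The functions `z ↦ Φ (b, j z)` for `b ∈ U`, extended by zero to all `b`. -/
def sliceFamily (hj : ContMDiff 𝓘(ℝ, F) 𝓘(ℝ, W) ∞ j)
    (hΦ : ∀ b ∈ U, ∀ z : M, ContDiffAt ℝ ∞ Φ (b, j z)) (b : E) : C^∞⟮𝓘(ℝ, F), M; ℝ⟯ :=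
  if hb : b ∈ U then slice hj b (hΦ b hb) else 0

omit [IsManifold 𝓘(ℝ, F) ∞ M] in
theorem sliceFamily_apply (hj : ContMDiff 𝓘(ℝ, F) 𝓘(ℝ, W) ∞ j)
    (hΦ : ∀ b ∈ U, ∀ z : M, ContDiffAt ℝ ∞ Φ (b, j z)) {b : E} (hb : b ∈ U) (z : M) :
    sliceFamily hj hΦ b z = Φ (b, j z) := by
  rw [sliceFamily, dif_pos hb]
  rfl

/-- On jets, the difference quotients of `f` are those of `partialJet`; they converge locally
uniformly, and commuting derivatives identify the limit with the jet of `f'`. -/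
theorem hasDirDerivAt_of_contDiffAt (hU : IsOpen U) (hj : ContMDiff 𝓘(ℝ, F) 𝓘(ℝ, W) ∞ j)
    (hΦ : ∀ b ∈ U, ∀ z : M, ContDiffAt ℝ ∞ Φ (b, j z)) {f f' : E → C^∞⟮𝓘(ℝ, F), M; ℝ⟯}
    (hf : ∀ b ∈ U, ∀ z, f b z = Φ (b, j z)) {v b : E} (hb : b ∈ U)
    (hf' : ∀ z, f' b z = fderiv ℝ Φ (b, j z) (v, 0)) :
    HasDirDerivAt f (f' b) b v := by
  refine tendsto_smoothFunctions_iff.2 fun x k => tendsto_continuousMap_of_forall fun y => ?_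
  have hs := hU.prod (chartAt F x).open_target
  have hΨ := contDiffOn_localExpr hj hΦ x
  have hp : ∀ y : (chartAt F x).target, (b, (y : F)) ∈ U ×ˢ (chartAt F x).target :=
    fun y => ⟨hb, y.2⟩
  have hlim : jet (E := F) x k (f' b) y =
      fderiv ℝ (partialJet (localExpr (F := F) j Φ x) k) (b, (y : F)) (v, 0) := by
    rw [fderiv_partialJet hs hΨ v k (hp y),
      jet_eq_partialJet (Φ := fun p => fderiv ℝ Φ p (v, 0)) hf' x k y, partialJet, partialJet]
    -- The two functions agree only on the chart target, but iterated derivatives depend on the germ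
    -- alone.
    refine (Filter.EventuallyEq.iteratedFDeriv ℝ ?_ k).eq_of_nhds
    filter_upwards [(chartAt F x).open_target.mem_nhds y.2] with w hw
    exact (partialFst_localExpr hj (hΦ b hb) x v hw).symm
  rw [hlim]
  have h := (tendsto_slope_prod v
    ((contDiffOn_partialJet hs hΨ k).contDiffAt (hs.mem_nhds (hp y)))).comp
    (Filter.tendsto_id.prodMap (continuous_subtype_val.tendsto y) :
      Filter.Tendsto _ (𝓝[≠] (0 : ℝ) ×ˢ 𝓝 y) _)
  refine h.congr' ?_
  have hev : ∀ᶠ t : ℝ in 𝓝[≠] 0, b + t • v ∈ U := by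
    have hc : Continuous fun t : ℝ => b + t • v := by fun_prop
    exact nhdsWithin_le_nhds (hc.continuousAt.eventually (hU.mem_nhds (by simpa using hb)))
  filter_upwards [Filter.tendsto_fst.eventually hev] with q hq
  simp only [map_smul, map_sub, ContinuousMap.smul_apply, ContinuousMap.sub_apply,
    jet_eq_partialJet (hf _ hq), jet_eq_partialJet (hf _ hb)]
  rfl

theorem continuousOn_of_contDiffAt (hU : IsOpen U) (hj : ContMDiff 𝓘(ℝ, F) 𝓘(ℝ, W) ∞ j)
    (hΦ : ∀ b ∈ U, ∀ z : M, ContDiffAt ℝ ∞ Φ (b, j z)) {f : E → C^∞⟮𝓘(ℝ, F), M; ℝ⟯}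
    (hf : ∀ b ∈ U, ∀ z, f b z = Φ (b, j z)) : ContinuousOn f U := by
  intro b hb
  refine tendsto_smoothFunctions_iff.2 fun x k => tendsto_continuousMap_of_forall fun y => ?_
  have hs := hU.prod (chartAt F x).open_target
  have hp : (b, (y : F)) ∈ U ×ˢ (chartAt F x).target := ⟨hb, y.2⟩
  have h := (contDiffOn_partialJet hs (contDiffOn_localExpr hj hΦ x) k).contDiffAt
    (hs.mem_nhds hp) |>.continuousAt.tendsto
  rw [nhds_prod_eq] at h
  rw [jet_eq_partialJet (hf b hb)]
  refine (h.comp ((Filter.tendsto_id'.2 nhdsWithin_le_nhds).prodMap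
    (continuous_subtype_val.tendsto y) : Filter.Tendsto _ (𝓝[U] b ×ˢ 𝓝 y) _)).congr' ?_
  filter_upwards [Filter.tendsto_fst.eventually self_mem_nhdsWithin] with q hq
  rw [jet_eq_partialJet (hf _ hq)]
  rfl

/-- A family of functions on `M` that is given by a jointly smooth expression is a smooth map into
the space of smooth functions. -/
theorem isSmoothOn_of_contDiffAt (hU : IsOpen U) (hj : ContMDiff 𝓘(ℝ, F) 𝓘(ℝ, W) ∞ j)
    (hΦ : ∀ b ∈ U, ∀ z : M, ContDiffAt ℝ ∞ Φ (b, j z)) {f : E → C^∞⟮𝓘(ℝ, F), M; ℝ⟯}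
    (hf : ∀ b ∈ U, ∀ z, f b z = Φ (b, j z)) : IsSmoothOn U f := by
  intro k
  induction k generalizing Φ f with
  | zero => exact continuousOn_of_contDiffAt hU hj hΦ hf
  | succ k ih =>
    refine ⟨continuousOn_of_contDiffAt hU hj hΦ hf, fun v => ?_⟩
    -- The parameter derivative is again jointly smooth, so the induction hypothesis applies to it
    -- in place of `Φ`.
    have hΦ' : ∀ b ∈ U, ∀ z : M, ContDiffAt ℝ ∞ (fun p => fderiv ℝ Φ p (v, 0)) (b, j z) :=
      fun b hb z => ((hΦ b hb z).fderiv_right (m := ∞) (by simp)).clm_apply contDiffAt_const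
    exact ⟨sliceFamily hj hΦ', fun b hb => hasDirDerivAt_of_contDiffAt hU hj hΦ hf hb
      (sliceFamily_apply hj hΦ' hb), ih hΦ' fun b hb => sliceFamily_apply hj hΦ' hb⟩

end SmoothFamilies

/-! ### A hyperbolic isometry with a fixed point on the sphere -/

section Boost

variable {𝕜 : Type} [RCLike 𝕜] {n : ℕ}

theorem J_eq_fromBlocks : J 𝕜 n = Matrix.fromBlocks 1 0 0 (-1) := by
  rw [J, LieAlgebra.Orthogonal.indefiniteDiagonal, ← Matrix.fromBlocks_diagonal,
    Matrix.diagonal_one]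
  congr 1

theorem J_mul_J : J 𝕜 n * J 𝕜 n = 1 := by
  simp [J_eq_fromBlocks, Matrix.fromBlocks_multiply]

/-- Makes the inverse a real-linear expression in the entries, which still makes sense away from the
group. -/
theorem coe_inv_eq (A : specialIsometries 𝕜 n) :
    (A⁻¹).1.1 = J 𝕜 n * A.1.1ᴴ * J 𝕜 n := by
  have h1 : J 𝕜 n * A.1.1ᴴ * J 𝕜 n * A.1.1 = 1 := by
    have hA : A.1.1ᴴ * J 𝕜 n * A.1.1 = J 𝕜 n := A.2
    simp only [Matrix.mul_assoc] at hA ⊢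
    rw [hA, J_mul_J]
  have h2 : A.1.1 * (A⁻¹).1.1 = 1 := congrArg (fun B => B.1.1) (mul_inv_cancel A)
  exact (left_inv_eq_right_inv h1 h2).symm

variable (𝕜 n) in
/-- A hyperbolic isometry with eigenvalue `2` that acts on the plane spanned by the first and the
last basis vector. -/
def boost : Matrix (Fin (n + 1) ⊕ Unit) (Fin (n + 1) ⊕ Unit) 𝕜 :=
  -- The entries `1 + 1/4 = 5/4` and `3/4` are `cosh (log 2)` and `sinh (log 2)`: their squares
  -- differ by 1 and their sum is 2.
  Matrix.fromBlocks (1 + Matrix.single 0 0 (1 / 4)) (Matrix.single 0 () (3 / 4))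
    (Matrix.single () 0 (3 / 4)) (Matrix.single () () (5 / 4))

theorem boost_conjTranspose : (boost 𝕜 n)ᴴ = boost 𝕜 n := by
  simp [boost, Matrix.fromBlocks_conjTranspose, Matrix.conjTranspose_single]

theorem boost_isometry : (boost 𝕜 n)ᴴ * J 𝕜 n * boost 𝕜 n = J 𝕜 n := by
  have h1 : (1 : Matrix Unit Unit 𝕜) = Matrix.single () () 1 := by ext; simp
  rw [boost_conjTranspose, J_eq_fromBlocks, boost, Matrix.fromBlocks_multiply,
    Matrix.fromBlocks_multiply]
  simp only [Matrix.mul_one, Matrix.mul_zero, add_zero, zero_add, Matrix.mul_neg,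
    Matrix.neg_mul, Matrix.single_mul_single_same, Matrix.add_mul, Matrix.mul_add, Matrix.one_mul, h1]
  congr 1
  · ext a b
    simp only [Matrix.add_apply, Matrix.single_apply, Matrix.neg_apply]
    split_ifs <;> ring
  · ext a b
    simp only [Matrix.add_apply, Matrix.single_apply, Matrix.neg_apply, Matrix.zero_apply]
    split_ifs <;> ring
  · ext a b
    simp only [Matrix.add_apply, Matrix.single_apply, Matrix.neg_apply, Matrix.zero_apply]
    split_ifs <;> ring
  · ext a b
    simp only [Matrix.add_apply, Matrix.single_apply, Matrix.neg_apply]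
    split_ifs <;> ring

/-- Since `boost` is a self-adjoint isometry, taking determinants of the isometry relation gives
`det² = 1`. Passing to the square thus avoids computing the determinant itself. -/
theorem boost_det_sq : (boost 𝕜 n * boost 𝕜 n).det = 1 := by
  have h := congrArg Matrix.det (boost_isometry (𝕜 := 𝕜) (n := n))
  have hJ : (J 𝕜 n).det ≠ 0 := fun h0 => by
    simpa [h0] using congrArg Matrix.det (J_mul_J (𝕜 := 𝕜) (n := n))
  rw [boost_conjTranspose, Matrix.det_mul, Matrix.det_mul] at h
  rw [Matrix.det_mul]
  exact mul_right_cancel₀ hJ (by linear_combination h)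

variable (𝕜 n) in
/-- The square of the hyperbolic isometry `boost`. -/
def boostSq : specialIsometries 𝕜 n :=
  ⟨⟨boost 𝕜 n * boost 𝕜 n, boost_det_sq⟩, by
    change (boost 𝕜 n * boost 𝕜 n)ᴴ * J 𝕜 n * (boost 𝕜 n * boost 𝕜 n) = J 𝕜 n
    calc _ = (boost 𝕜 n)ᴴ * ((boost 𝕜 n)ᴴ * J 𝕜 n * boost 𝕜 n) * boost 𝕜 n := by
          simp [Matrix.conjTranspose_mul, Matrix.mul_assoc]
      _ = J 𝕜 n := by rw [boost_isometry, boost_isometry]⟩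

variable (𝕜 n) in
/-- The first basis vector as a point of the sphere. -/
def basePoint : Sph 𝕜 n := ⟨EuclideanSpace.single 0 1, by simp⟩

theorem boost_mulVec : boost 𝕜 n *ᵥ Sum.elim (basePoint 𝕜 n).1.ofLp (fun _ => (1 : 𝕜)) =
    (2 : 𝕜) • Sum.elim (basePoint 𝕜 n).1.ofLp (fun _ => (1 : 𝕜)) := by
  rw [boost, Matrix.fromBlocks_mulVec]
  ext i
  rcases i with i | i
  · by_cases h : i = 0
    · subst h
      simp [basePoint, Matrix.mulVec, dotProduct]
      norm_num
    · simp [basePoint, Matrix.mulVec, dotProduct, h,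
        Ne.symm h]
  · simp [basePoint, Matrix.mulVec, dotProduct]
    norm_num

theorem lift_boostSq : lift (boostSq 𝕜 n).1.1 (basePoint 𝕜 n).1 =
    (4 : 𝕜) • Sum.elim (basePoint 𝕜 n).1.ofLp (fun _ => (1 : 𝕜)) := by
  change (boost 𝕜 n * boost 𝕜 n) *ᵥ _ = _
  rw [← Matrix.mulVec_mulVec, boost_mulVec, Matrix.mulVec_smul, boost_mulVec, smul_smul]
  norm_num

theorem boostSq_smul_basePoint : boostSq 𝕜 n • basePoint 𝕜 n = basePoint 𝕜 n := by
  apply Subtype.ext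
  change frac (boostSq 𝕜 n).1.1 (basePoint 𝕜 n).1 = _
  ext i
  simp [frac, lift_boostSq]

end Boost

/-! ### The logarithmic cocycle and its smoothness -/

section LogCocycle

variable {𝕜 : Type} [RCLike 𝕜] {n : ℕ}

/-- The last coordinate of `A⁻¹ (x, 1)` as a function of the entries of an isometry `A`. -/
def lastCoord (B : Matrix (Fin (n + 1) ⊕ Unit) (Fin (n + 1) ⊕ Unit) 𝕜)
    (x : EuclideanSpace 𝕜 (Fin (n + 1))) : 𝕜 :=
  star (B (Sum.inr ()) (Sum.inr ())) - ∑ i, star (B (Sum.inl i) (Sum.inr ())) * x i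

/-- The last row of `J Aᴴ J` is the conjugated last column of `A`, with signs changed by `J` except
in the last entry. -/
theorem lastCoord_eq (A : specialIsometries 𝕜 n) (x : EuclideanSpace 𝕜 (Fin (n + 1))) :
    lastCoord A.1.1 x = lift (A⁻¹).1.1 x (Sum.inr ()) := by
  rw [coe_inv_eq, lift, lastCoord, J, LieAlgebra.Orthogonal.indefiniteDiagonal]
  simp [Matrix.mulVec, dotProduct, Matrix.mul_diagonal, Matrix.diagonal_mul]
  ring

section

-- The entrywise sup norm serves only to speak of `ContDiff`; it induces the product topology used
-- in `IsSmooth`.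
attribute [local instance] Matrix.normedAddCommGroup Matrix.normedSpace

theorem contDiff_lastCoord : ContDiff ℝ ∞ fun p :
    Matrix (Fin (n + 1) ⊕ Unit) (Fin (n + 1) ⊕ Unit) 𝕜 × EuclideanSpace 𝕜 (Fin (n + 1)) =>
      lastCoord p.1 p.2 := by
  have h : ∀ i j, ContDiff ℝ ∞ fun p :
      Matrix (Fin (n + 1) ⊕ Unit) (Fin (n + 1) ⊕ Unit) 𝕜 × EuclideanSpace 𝕜 (Fin (n + 1)) =>
        star (p.1 i j) := fun i j =>
    (RCLike.conjCLE (K := 𝕜)).contDiff.comp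
      ((contDiff_apply_apply ℝ 𝕜 i j).comp contDiff_fst)
  have hx : ∀ i, ContDiff ℝ ∞ fun p :
      Matrix (Fin (n + 1) ⊕ Unit) (Fin (n + 1) ⊕ Unit) 𝕜 × EuclideanSpace 𝕜 (Fin (n + 1)) =>
        p.2 i := fun i => by fun_prop
  exact (h _ _).sub (ContDiff.sum fun i _ => (h _ _).mul (hx i))

/-- The logarithm of the squared modulus of the last coordinate of `A⁻¹ (x, 1)`. -/
def logLastCoord (p : Matrix (Fin (n + 1) ⊕ Unit) (Fin (n + 1) ⊕ Unit) 𝕜 ×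
    EuclideanSpace 𝕜 (Fin (n + 1))) : ℝ :=
  Real.log (RCLike.normSq (lastCoord p.1 p.2))

theorem contDiffAt_logLastCoord {p : Matrix (Fin (n + 1) ⊕ Unit) (Fin (n + 1) ⊕ Unit) 𝕜 ×
    EuclideanSpace 𝕜 (Fin (n + 1))} (hp : lastCoord p.1 p.2 ≠ 0) :
    ContDiffAt ℝ ∞ logLastCoord p := by
  have hre := ((RCLike.reCLM (K := 𝕜)).contDiff.comp (contDiff_lastCoord (n := n))).contDiffAt
    (x := p)
  have him := ((RCLike.imCLM (K := 𝕜)).contDiff.comp (contDiff_lastCoord (n := n))).contDiffAt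
    (x := p)
  refine ContDiffAt.log ?_ (by simpa using hp)
  simp only [RCLike.normSq_apply]
  exact (hre.mul hre).add (him.mul him)

variable (𝕜 n) in
/-- The matrices for which the last coordinate vanishes nowhere on the sphere. -/
def regularMatrices : Set (Matrix (Fin (n + 1) ⊕ Unit) (Fin (n + 1) ⊕ Unit) 𝕜) :=
  {B | ∀ x : Sph 𝕜 n, lastCoord B x.1 ≠ 0}

theorem coe_mem_regularMatrices (A : specialIsometries 𝕜 n) : A.1.1 ∈ regularMatrices 𝕜 n :=
  fun x => by rw [lastCoord_eq]; exact lift_last_ne_zero _ _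

/-- Nonvanishing is an open condition in `(B, x)`, and compactness of the sphere makes it uniform in
`x` (tube lemma). -/
theorem isOpen_regularMatrices : IsOpen (regularMatrices 𝕜 n) := by
  rw [isOpen_iff_eventually]
  intro B hB
  have h := (isCompact_sphere (0 : EuclideanSpace 𝕜 (Fin (n + 1))) 1)
    |>.eventually_forall_of_forall_eventually (x₀ := B) (P := fun B x => lastCoord B x ≠ 0)
    fun x hx => contDiff_lastCoord.continuous.continuousAt.eventually_ne (hB ⟨x, hx⟩)
  filter_upwards [h] with C hC x using hC x.1 x.2

variable {d : ℕ} [ChartedSpace (EuclideanSpace ℝ (Fin d)) (Sph 𝕜 n)]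
  [IsManifold (𝓡 d) ∞ (Sph 𝕜 n)]

/-- The logarithmic cocycle on arbitrary matrices, with value zero at matrices for which the
logarithm is not defined everywhere. -/
def logFamily (hj : ContMDiff (𝓡 d) 𝓘(ℝ, EuclideanSpace 𝕜 (Fin (n + 1))) ∞
    (Subtype.val : Sph 𝕜 n → _)) (B : Matrix (Fin (n + 1) ⊕ Unit) (Fin (n + 1) ⊕ Unit) 𝕜) :
    C^∞⟮𝓡 d, Sph 𝕜 n; ℝ⟯ :=
  sliceFamily (U := regularMatrices 𝕜 n) hj
    (fun B hB x => contDiffAt_logLastCoord (p := (B, x.1)) (hB x)) B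

omit [IsManifold (𝓡 d) ∞ (Sph 𝕜 n)] in
theorem logFamily_apply (hj : ContMDiff (𝓡 d) 𝓘(ℝ, EuclideanSpace 𝕜 (Fin (n + 1))) ∞
    (Subtype.val : Sph 𝕜 n → _)) {B : Matrix (Fin (n + 1) ⊕ Unit) (Fin (n + 1) ⊕ Unit) 𝕜}
    (hB : B ∈ regularMatrices 𝕜 n) (x : Sph 𝕜 n) :
    logFamily hj B x = logLastCoord (B, x.1) :=
  sliceFamily_apply hj _ hB x

theorem isSmoothOn_logFamily (hj : ContMDiff (𝓡 d) 𝓘(ℝ, EuclideanSpace 𝕜 (Fin (n + 1))) ∞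
    (Subtype.val : Sph 𝕜 n → _)) : IsSmoothOn (regularMatrices 𝕜 n) (logFamily hj) :=
  isSmoothOn_of_contDiffAt isOpen_regularMatrices hj
    (fun B hB x => contDiffAt_logLastCoord (p := (B, x.1)) (hB x))
    (fun _ hB x => logFamily_apply hj hB x)

end

/-! ### The nontrivial cohomology class -/

variable {d : ℕ} [ChartedSpace (EuclideanSpace ℝ (Fin d)) (Sph 𝕜 n)]
  [IsManifold (𝓡 d) ∞ (Sph 𝕜 n)]

/-- The logarithmic cocycle of the action on the sphere. -/
def logCocycle (hj : ContMDiff (𝓡 d) 𝓘(ℝ, EuclideanSpace 𝕜 (Fin (n + 1))) ∞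
    (Subtype.val : Sph 𝕜 n → _)) (A : specialIsometries 𝕜 n) : C^∞⟮𝓡 d, Sph 𝕜 n; ℝ⟯ :=
  logFamily hj A.1.1

omit [IsManifold (𝓡 d) ∞ (Sph 𝕜 n)] in
theorem logCocycle_apply (hj : ContMDiff (𝓡 d) 𝓘(ℝ, EuclideanSpace 𝕜 (Fin (n + 1))) ∞
    (Subtype.val : Sph 𝕜 n → _)) (A : specialIsometries 𝕜 n) (x : Sph 𝕜 n) :
    logCocycle hj A x = Real.log (RCLike.normSq (lift (A⁻¹).1.1 x.1 (Sum.inr ()))) := by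
  rw [logCocycle, logFamily_apply hj (coe_mem_regularMatrices A), logLastCoord, lastCoord_eq]

theorem isSmooth_logCocycle (hj : ContMDiff (𝓡 d) 𝓘(ℝ, EuclideanSpace 𝕜 (Fin (n + 1))) ∞
    (Subtype.val : Sph 𝕜 n → _)) : IsSmooth (specialIsometries 𝕜 n) (logCocycle hj) := fun A =>
  ⟨regularMatrices 𝕜 n, isOpen_regularMatrices, coe_mem_regularMatrices A, logFamily hj,
    isSmoothOn_logFamily hj, fun _ _ => rfl⟩

theorem logCocycle_mem_Z1d (hj : ContMDiff (𝓡 d) 𝓘(ℝ, EuclideanSpace 𝕜 (Fin (n + 1))) ∞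
    (Subtype.val : Sph 𝕜 n → _))
    (hG : ∀ A : specialIsometries 𝕜 n, ContMDiff (𝓡 d) (𝓡 d) ∞ (fun x : Sph 𝕜 n => A • x)) :
    logCocycle hj ∈ Z1d (functionModule (specialIsometries 𝕜 n) hG) := by
  refine ⟨?_, isSmooth_logCocycle hj⟩
  rw [SetLike.mem_coe, LinearMap.mem_ker]
  ext p x
  obtain ⟨A, B⟩ := p
  change logCocycle hj B (A⁻¹ • x) - logCocycle hj (A * B) x + logCocycle hj A x = 0
  rw [logCocycle_apply, logCocycle_apply, logCocycle_apply, mul_inv_rev, lift_mul]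
  -- Both factors must be nonzero, since the convention `Real.log 0 = 0` breaks additivity of the
  -- logarithm.
  have h1 := lift_last_ne_zero A⁻¹ x
  have h2 := lift_last_ne_zero B⁻¹ (A⁻¹ • x)
  change Real.log (RCLike.normSq (lift (B⁻¹).1.1 (frac (A⁻¹).1.1 x.1) (Sum.inr ()))) - _ + _ = 0
  change lift (B⁻¹).1.1 (frac (A⁻¹).1.1 x.1) (Sum.inr ()) ≠ 0 at h2
  rw [Pi.smul_apply, smul_eq_mul, map_mul, Real.log_mul (by simpa using h1) (by simpa using h2)]
  ring

omit [IsManifold (𝓡 d) ∞ (Sph 𝕜 n)] in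
theorem logCocycle_not_mem_B1d (hj : ContMDiff (𝓡 d) 𝓘(ℝ, EuclideanSpace 𝕜 (Fin (n + 1))) ∞
    (Subtype.val : Sph 𝕜 n → _))
    (hG : ∀ A : specialIsometries 𝕜 n, ContMDiff (𝓡 d) (𝓡 d) ∞ (fun x : Sph 𝕜 n => A • x)) :
    logCocycle hj ∉ B1d (functionModule (specialIsometries 𝕜 n) hG) := by
  rintro ⟨f, hf⟩
  -- The cocycle at `A` involves `A⁻¹`, so it is evaluated at the inverse of `boostSq`, where the
  -- known factor 4 appears directly.
  have h : f ((boostSq 𝕜 n)⁻¹⁻¹ • basePoint 𝕜 n) - f (basePoint 𝕜 n) =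
      logCocycle hj (boostSq 𝕜 n)⁻¹ (basePoint 𝕜 n) := by
    rw [← hf]
    rfl
  rw [logCocycle_apply, inv_inv, boostSq_smul_basePoint, sub_self, lift_boostSq] at h
  have h16 : RCLike.normSq (4 : 𝕜) = 16 := by
    rw [RCLike.normSq_eq_def', RCLike.norm_ofNat]
    norm_num
  simp only [Pi.smul_apply, Sum.elim_inr, smul_eq_mul, mul_one, h16] at h
  exact (Real.log_pos (by norm_num : (1 : ℝ) < 16)).ne h

/-- The dimension `d` is left free so that one statement covers `d = 2 n + 1` over `ℂ` and `d = n`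
over `ℝ`; the manifold structure enters through smoothness of the inclusion and of the action. -/
theorem nontrivial_H1d (hj : ContMDiff (𝓡 d) 𝓘(ℝ, EuclideanSpace 𝕜 (Fin (n + 1))) ∞
    (Subtype.val : Sph 𝕜 n → _))
    (hG : ∀ A : specialIsometries 𝕜 n, ContMDiff (𝓡 d) (𝓡 d) ∞ (fun x : Sph 𝕜 n => A • x)) :
    Nontrivial (H1d (functionModule (specialIsometries 𝕜 n) hG)) := by
  refine Submodule.Quotient.nontrivial_iff.2 fun h => logCocycle_not_mem_B1d hj hG ?_
  have := h ▸ (Submodule.mem_top :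
    (⟨_, logCocycle_mem_Z1d hj hG⟩ : Z1d (functionModule (specialIsometries 𝕜 n) hG)) ∈ _)
  exact this

end LogCocycle

end DiffCohomology

end

open DiffCohomology in
theorem mainTheorem10 (n : ℕ) :
    Nontrivial (H1d (moduleSU n)) ∧ Nontrivial (H1d (moduleSO n)) := by
  have hC : ContMDiff (𝓡 (2 * n + 1)) 𝓘(ℝ, EuclideanSpace ℂ (Fin (n + 1))) ∞
    (Subtype.val : Sph ℂ n → _) := contMDiff_coe_sphere
  have hR : ContMDiff (𝓡 n) 𝓘(ℝ, EuclideanSpace ℝ (Fin (n + 1))) ∞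
    (Subtype.val : Sph ℝ n → _) := contMDiff_coe_sphere
  exact ⟨nontrivial_H1d hC (contMDiff_SU n), nontrivial_H1d hR (contMDiff_SO n)⟩
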